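/- For a finite set $P\subset\mathbb{R}^2$ with an even number of points, no three of them collinear, a halving line of $P$ is a line through two distinct points of $P$ that has equally many of the remaining points of $P$ on each of its two sides. The underlying graph of $P$ is the graph with vertex set $P$ in which two distinct points are adjacent if and only if the line through them is a halving line of $P$. Theorem. Let $G$ be a finite simple graph with $2k$ vertices and $e$ edges. Then there is a finite set $P\subset\mathbb{R}^2$ with an even number of points, no three of them collinear, such that $G$ is isomorphic to an induced subgraph of the underlying graph of $P$ and $$|P| \le 2k+2ek-4e+2\binom{2k}{2}.$$ -/

import Mathlib

namespace HalvingLines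

/-- The Euclidean plane. -/
abbrev Plane : Type := EuclideanSpace ℝ (Fin 2)

/-- Twice the signed area of the triangle `p q r`. For `p ≠ q` it vanishes exactly when `r` lies on
the line through `p` and `q`; it is positive exactly when `r` lies strictly to the left of that line
(directed from `p` to `q`), and negative exactly when `r` lies strictly to the right. -/
noncomputable def orient (p q r : Plane) : ℝ :=
  (q 0 - p 0) * (r 1 - p 1) - (q 1 - p 1) * (r 0 - p 0)

theorem orient_swap (p q r : Plane) : orient q p r = -orient p q r := by
  unfold orient; ring

/-- No three distinct points of `P` are collinear. -/
def InGeneralPosition (P : Finset Plane) : Prop :=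
  ∀ p ∈ P, ∀ q ∈ P, ∀ r ∈ P, p ≠ q → p ≠ r → q ≠ r → ¬ Collinear ℝ {p, q, r}

open Classical in
/-- The points of `P` strictly to the left of the line through `p` and `q`. -/
noncomputable def leftSide (P : Finset Plane) (p q : Plane) : Finset Plane :=
  P.filter fun r => 0 < orient p q r

open Classical in
/-- The points of `P` strictly to the right of the line through `p` and `q`. -/
noncomputable def rightSide (P : Finset Plane) (p q : Plane) : Finset Plane :=
  P.filter fun r => orient p q r < 0

theorem leftSide_swap (P : Finset Plane) (p q : Plane) : leftSide P q p = rightSide P p q := by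
  classical
  ext r
  simp [leftSide, rightSide, orient_swap p q r]

theorem rightSide_swap (P : Finset Plane) (p q : Plane) : rightSide P q p = leftSide P p q :=
  (leftSide_swap P q p).symm

/-- The line through the two distinct points `p` and `q` of `P` is a halving line of `P`: it has
equally many points of `P` on its two sides. -/
def IsHalvingLine (P : Finset Plane) (p q : Plane) : Prop :=
  p ∈ P ∧ q ∈ P ∧ p ≠ q ∧ (leftSide P p q).card = (rightSide P p q).card

theorem IsHalvingLine.symm {P : Finset Plane} {p q : Plane} (h : IsHalvingLine P p q) :
    IsHalvingLine P q p :=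
  ⟨h.2.1, h.1, h.2.2.1.symm, by rw [leftSide_swap P p q, rightSide_swap P p q]; exact h.2.2.2.symm⟩

/-- The underlying graph of `P`: its vertices are the points of `P`, and two of them are adjacent
when the line through them is a halving line of `P`. -/
def underlyingGraph (P : Finset Plane) : SimpleGraph {p : Plane // p ∈ P} where
  Adj p q := IsHalvingLine P p q
  symm := ⟨fun _ _ h => h.symm⟩
  loopless := ⟨fun _ h => h.2.2.1 rfl⟩

end HalvingLines

namespace HalvingLines

open Filter

/-! ### Quadratic polynomials at infinity -/

/-! Place the vertices so that no two of their connecting lines are parallel. Far out along the line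
`v w`, add one point in each direction, both just left of it: its imbalance (left count minus right
count) grows by 2, while every other vertex line crosses `v w`, has one new point on each side, and
keeps its imbalance (`exists_add_pair`). So the pairs can be treated independently. An edge starts
with even imbalance of size at most `2k - 2` and is balanced by that many points; a non-edge needs
at most 2 points to become unbalanced. The total is at most `2k + e(2k - 2) + 2(C(2k,2) - e)`. -/

theorem eventually_quadratic_pos {a b c : ℝ} (h : 0 < a ∨ a = 0 ∧ 0 < b) :
    ∀ᶠ t : ℝ in atTop, 0 < a * t ^ 2 + b * t + c := by
  rcases h with ha | ⟨rfl, hb⟩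
  · filter_upwards [eventually_gt_atTop 1, eventually_gt_atTop ((|b| + |c|) / a)] with t h1 h2
    rw [div_lt_iff₀ ha] at h2
    have hb := neg_abs_le b
    have hc := neg_abs_le c
    have hc0 := abs_nonneg c
    nlinarith [mul_pos (sub_pos.2 h2) (by linarith : 0 < t), mul_nonneg hc0 (sub_pos.2 h1).le,
      mul_nonneg (neg_le_iff_add_nonneg.1 hb) (by linarith : 0 ≤ t)]
  · filter_upwards [eventually_gt_atTop (-c / b)] with t h2
    rw [div_lt_iff₀ hb] at h2
    linarith

theorem eventually_quadratic_ne_zero {a b c : ℝ} (h : a ≠ 0 ∨ b ≠ 0) :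
    ∀ᶠ t : ℝ in atTop, a * t ^ 2 + b * t + c ≠ 0 := by
  have key : (0 < a ∨ a = 0 ∧ 0 < b) ∨ (0 < -a ∨ -a = 0 ∧ 0 < -b) := by
    rcases lt_trichotomy a 0 with ha | ha | ha
    · right; left; linarith
    · subst ha
      rcases lt_or_gt_of_ne (h.resolve_left (by simp)) with hb | hb
      · right; right; simpa using hb
      · left; right; simpa using hb
    · left; left; exact ha
  rcases key with h | h
  · exact (eventually_quadratic_pos (c := c) h).mono fun t ht => ht.ne'
  · refine (eventually_quadratic_pos (c := -c) h).mono fun t ht => ?_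
    intro h0
    linarith

/-! ### Orientation and general position -/

/-- The determinant of the direction vectors of the lines `p q` and `r s`. -/
noncomputable def cross (p q r s : Plane) : ℝ :=
  (q 0 - p 0) * (s 1 - r 1) - (q 1 - p 1) * (s 0 - r 0)

theorem orient_self_left (p q : Plane) : orient p q p = 0 := by simp [orient]

theorem orient_self_right (p q : Plane) : orient p q q = 0 := by unfold orient; ring

theorem orient_rotate (p q r : Plane) : orient q r p = orient p q r := by unfold orient; ring

/-- The three points of any triangle of `P` span a triangle of nonzero area. -/
def Generic (P : Finset Plane) : Prop :=
  ∀ p ∈ P, ∀ q ∈ P, ∀ r ∈ P, p ≠ q → p ≠ r → q ≠ r → orient p q r ≠ 0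

theorem orient_eq_zero_of_collinear {p q r : Plane} (h : Collinear ℝ {p, q, r}) :
    orient p q r = 0 := by
  obtain ⟨v, hv⟩ := (collinear_iff_of_mem (p₀ := p) (by simp)).1 h
  obtain ⟨s, rfl⟩ := hv q (by simp)
  obtain ⟨t, rfl⟩ := hv r (by simp)
  simp [orient]
  ring

theorem Generic.inGeneralPosition {P : Finset Plane} (h : Generic P) : InGeneralPosition P :=
  fun p hp q hq r hr hpq hpr hqr hc =>
    h p hp q hq r hr hpq hpr hqr (orient_eq_zero_of_collinear hc)

open Classical in
theorem Generic.insert {P : Finset Plane} (h : Generic P) {a : Plane}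
    (ha : ∀ p ∈ P, ∀ q ∈ P, p ≠ q → orient p q a ≠ 0) : Generic (insert a P) := by
  intro p hp q hq r hr hpq hpr hqr
  rw [Finset.mem_insert] at hp hq hr
  rcases hp with rfl | hp
  · have hq := hq.resolve_left hpq.symm
    have hr := hr.resolve_left hpr.symm
    rw [← orient_rotate]
    exact ha q hq r hr hqr
  rcases hq with rfl | hq
  · have hr := hr.resolve_left hqr.symm
    rw [← orient_rotate, ← orient_rotate]
    exact ha r hr p hp hpr.symm
  rcases hr with rfl | hr
  · exact ha p hp q hq hpq
  · exact h p hp q hq r hr hpq hpr hqr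

theorem not_mem_of_orient_ne_zero {P : Finset Plane} {a p q : Plane} (hp : p ∈ P) (hq : q ∈ P)
    (hpq : p ≠ q) (ha : ∀ p ∈ P, ∀ q ∈ P, p ≠ q → orient p q a ≠ 0) : a ∉ P := by
  intro haP
  by_cases h : a = p
  · subst h
    exact ha a hp q hq hpq (orient_self_left _ _)
  · exact ha a haP p hp h (orient_self_left _ _)

/-- The point of the parabola with axis direction `q - p`, opening in the sense of `ε`, at
parameter `t`. -/
noncomputable def farPoint (p q : Plane) (ε t : ℝ) : Plane :=
  !₂[p 0 + ε * t ^ 2 * (q 0 - p 0) - t * (q 1 - p 1),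
     p 1 + ε * t ^ 2 * (q 1 - p 1) + t * (q 0 - p 0)]

/-- The quadratic coefficient is the determinant of the two directions, the linear one their dot
product: far out, the first decides the side, and for parallel lines the second does. -/
theorem orient_farPoint (p q r s : Plane) (ε t : ℝ) :
    orient r s (farPoint p q ε t) =
      (ε * cross r s p q) * t ^ 2
        + ((s 0 - r 0) * (q 0 - p 0) + (s 1 - r 1) * (q 1 - p 1)) * t + orient r s p := by
  simp [orient, farPoint, cross]
  ring

theorem sq_add_sq_pos {p q : Plane} (h : p ≠ q) :
    0 < (q 0 - p 0) * (q 0 - p 0) + (q 1 - p 1) * (q 1 - p 1) := by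
  by_contra hn
  apply h
  have h0 : q 0 - p 0 = 0 := by nlinarith [mul_self_nonneg (q 0 - p 0), mul_self_nonneg (q 1 - p 1)]
  have h1 : q 1 - p 1 = 0 := by nlinarith [mul_self_nonneg (q 0 - p 0), mul_self_nonneg (q 1 - p 1)]
  ext i
  fin_cases i
  · simpa using (sub_eq_zero.1 h0).symm
  · simpa using (sub_eq_zero.1 h1).symm

theorem eventually_orient_farPoint_ne_zero {p q r s : Plane} (hpq : p ≠ q) (hrs : r ≠ s) {ε : ℝ}
    (hε : ε ≠ 0) : ∀ᶠ t in atTop, orient r s (farPoint p q ε t) ≠ 0 := by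
  simp only [orient_farPoint]
  apply eventually_quadratic_ne_zero
  by_contra! h
  obtain ⟨h1, h2⟩ := h
  replace h1 := (mul_eq_zero.1 h1).resolve_left hε
  unfold cross at h1
  have hu := sq_add_sq_pos hpq
  have hv := sq_add_sq_pos hrs
  -- Lagrange's identity: the squared lengths multiply to dot² + det², so both coefficients cannot
  -- vanish.
  have : ((q 0 - p 0) * (q 0 - p 0) + (q 1 - p 1) * (q 1 - p 1)) *
      ((s 0 - r 0) * (s 0 - r 0) + (s 1 - r 1) * (s 1 - r 1)) = 0 := by
    linear_combination ((s 0 - r 0) * (q 0 - p 0) + (s 1 - r 1) * (q 1 - p 1)) * h2 +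
      ((s 0 - r 0) * (q 1 - p 1) - (s 1 - r 1) * (q 0 - p 0)) * h1
  exact (mul_pos hu hv).ne' this

theorem eventually_cross_mul_orient_farPoint_pos {p q r s : Plane} (h : cross r s p q ≠ 0) {ε : ℝ}
    (hε : ε ≠ 0) : ∀ᶠ t in atTop, 0 < ε * cross r s p q * orient r s (farPoint p q ε t) := by
  have hp : 0 < (ε * cross r s p q) * (ε * cross r s p q) :=
    mul_self_pos.2 (mul_ne_zero hε h)
  refine (eventually_quadratic_pos (b := (ε * cross r s p q) *
    ((s 0 - r 0) * (q 0 - p 0) + (s 1 - r 1) * (q 1 - p 1)))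
    (c := ε * cross r s p q * orient r s p) (Or.inl hp)).mono fun t ht => ?_
  rw [orient_farPoint]
  linarith

/-- The quadratic term vanishes and the linear one is a squared length, so both ends of the line (`ε
= ±1`) give points on its left. -/
theorem eventually_orient_farPoint_self_pos {p q : Plane} (h : p ≠ q) (ε : ℝ) :
    ∀ᶠ t in atTop, 0 < orient p q (farPoint p q ε t) := by
  simp only [orient_farPoint]
  exact eventually_quadratic_pos (Or.inr ⟨by unfold cross; ring, sq_add_sq_pos h⟩)

/-! ### The imbalance of a line -/

/-- The number of points of `P` to the left of the line `p q` minus the number to its right. -/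
noncomputable def imbalance (P : Finset Plane) (p q : Plane) : ℤ :=
  (leftSide P p q).card - (rightSide P p q).card

theorem imbalance_swap (P : Finset Plane) (p q : Plane) :
    imbalance P q p = -imbalance P p q := by
  unfold imbalance
  rw [leftSide_swap P p q, rightSide_swap P p q]
  ring

open Classical in
theorem imbalance_insert_of_pos {P : Finset Plane} {a p q : Plane} (ha : a ∉ P)
    (h : 0 < orient p q a) : imbalance (insert a P) p q = imbalance P p q + 1 := by
  unfold imbalance leftSide rightSide
  rw [Finset.filter_insert, Finset.filter_insert, if_pos h, if_neg h.not_gt,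
    Finset.card_insert_of_notMem (by simp [ha])]
  push_cast
  ring

open Classical in
theorem imbalance_insert_of_neg {P : Finset Plane} {a p q : Plane} (ha : a ∉ P)
    (h : orient p q a < 0) : imbalance (insert a P) p q = imbalance P p q - 1 := by
  have := imbalance_insert_of_pos (P := P) (p := q) (q := p) ha (by rw [orient_swap]; linarith)
  rw [imbalance_swap, imbalance_swap P] at this
  linarith

theorem Generic.card_leftSide_add_card_rightSide {P : Finset Plane} (h : Generic P) {p q : Plane}
    (hp : p ∈ P) (hq : q ∈ P) (hpq : p ≠ q) :
    (leftSide P p q).card + (rightSide P p q).card + 2 = P.card := by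
  classical
  have hd : Disjoint (leftSide P p q) (rightSide P p q) := by
    rw [Finset.disjoint_left]
    intro r hr hr'
    simp only [leftSide, rightSide, Finset.mem_filter] at hr hr'
    linarith [hr.2, hr'.2]
  have hd' : Disjoint (leftSide P p q ∪ rightSide P p q) {p, q} := by
    rw [Finset.disjoint_right]
    intro r hr
    simp only [Finset.mem_insert, Finset.mem_singleton] at hr
    rcases hr with rfl | rfl <;>
      simp [leftSide, rightSide, orient_self_left, orient_self_right]
  have hu : leftSide P p q ∪ rightSide P p q ∪ {p, q} = P := by
    ext r
    simp only [leftSide, rightSide, Finset.mem_union, Finset.mem_filter, Finset.mem_insert,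
      Finset.mem_singleton]
    constructor
    · rintro ((h | h) | rfl | rfl)
      exacts [h.1, h.1, hp, hq]
    · intro hr
      by_cases h1 : r = p
      · simp [h1]
      by_cases h2 : r = q
      · simp [h2]
      have := h p hp q hq r hr hpq (Ne.symm h1) (Ne.symm h2)
      rcases lt_or_gt_of_ne this with h' | h' <;> simp [hr, h']
  rw [← Finset.card_pair hpq, ← Finset.card_union_of_disjoint hd,
    ← Finset.card_union_of_disjoint hd', hu]

/-! ### Adding points far away -/

/-- The points `f v` are distinct, and lines through different pairs of them are not parallel. -/
structure NoParallels {V : Type*} (f : V → Plane) : Prop where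
  injective : Function.Injective f
  cross_ne_zero : ∀ v w x y, v ≠ w → x ≠ y → s(v, w) ≠ s(x, y) →
    cross (f v) (f w) (f x) (f y) ≠ 0

variable {V : Type*} [Finite V] {f : V → Plane}

open Classical in
theorem NoParallels.exists_add_pair (hf : NoParallels f) {P : Finset Plane} (hP : Generic P)
    (hfP : ∀ v, f v ∈ P) {v w : V} (hvw : v ≠ w) :
    ∃ Q : Finset Plane, Generic Q ∧ P ⊆ Q ∧ Q.card = P.card + 2 ∧
      imbalance Q (f v) (f w) = imbalance P (f v) (f w) + 2 ∧
      ∀ x y, x ≠ y → s(x, y) ≠ s(v, w) →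
        imbalance Q (f x) (f y) = imbalance P (f x) (f y) := by
  have hne : f v ≠ f w := hf.injective.ne hvw
  have key : ∀ (R : Finset Plane) (ε : ℝ), ε ≠ 0 → ∃ a : Plane,
      (∀ p ∈ R, ∀ q ∈ R, p ≠ q → orient p q a ≠ 0) ∧ 0 < orient (f v) (f w) a ∧
      ∀ x y, x ≠ y → s(x, y) ≠ s(v, w) →
        0 < ε * cross (f x) (f y) (f v) (f w) * orient (f x) (f y) a := by
    intro R ε hε
    have h1 : ∀ᶠ t in atTop, ∀ p ∈ R, ∀ q ∈ R, p ≠ q →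
        orient p q (farPoint (f v) (f w) ε t) ≠ 0 := by
      rw [Finset.eventually_all]
      intro p _
      rw [Finset.eventually_all]
      intro q _
      rw [eventually_all]
      exact fun hpq => eventually_orient_farPoint_ne_zero hne hpq hε
    have h2 : ∀ᶠ t in atTop, ∀ x y, x ≠ y → s(x, y) ≠ s(v, w) →
        0 < ε * cross (f x) (f y) (f v) (f w) *
          orient (f x) (f y) (farPoint (f v) (f w) ε t) := by
      simp only [eventually_all]
      exact fun x y hxy hs =>
        eventually_cross_mul_orient_farPoint_pos (hf.cross_ne_zero _ _ _ _ hxy hvw hs) hε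
    obtain ⟨t, ht1, ht2, ht3⟩ :=
      (h1.and ((eventually_orient_farPoint_self_pos hne ε).and h2)).exists
    exact ⟨_, ht1, ht2, ht3⟩
  obtain ⟨a, ha, hav, hao⟩ := key P 1 one_ne_zero
  have haP : a ∉ P := not_mem_of_orient_ne_zero (hfP v) (hfP w) hne ha
  -- The opposite end of the line; `b` must also avoid the lines through `a`.
  obtain ⟨b, hb, hbv, hbo⟩ := key (insert a P) (-1) (by norm_num)
  have hbP : b ∉ insert a P := not_mem_of_orient_ne_zero (Finset.mem_insert_of_mem (hfP v))
    (Finset.mem_insert_of_mem (hfP w)) hne hb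
  refine ⟨insert b (insert a P), (hP.insert ha).insert hb,
    (Finset.subset_insert _ _).trans (Finset.subset_insert _ _), ?_, ?_, ?_⟩
  · rw [Finset.card_insert_of_notMem hbP, Finset.card_insert_of_notMem haP]
  · rw [imbalance_insert_of_pos hbP hbv, imbalance_insert_of_pos haP hav]
    ring
  · intro x y hxy hs
    have h1 := hao x y hxy hs
    have h2 := hbo x y hxy hs
    rcases lt_or_gt_of_ne (hf.cross_ne_zero _ _ _ _ hxy hvw hs) with hc | hc
    · rw [imbalance_insert_of_pos hbP (by nlinarith), imbalance_insert_of_neg haP (by nlinarith)]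
      ring
    · rw [imbalance_insert_of_neg hbP (by nlinarith), imbalance_insert_of_pos haP (by nlinarith)]
      ring

theorem NoParallels.exists_add_pairs (hf : NoParallels f) {P : Finset Plane} (hP : Generic P)
    (hfP : ∀ v, f v ∈ P) {v w : V} (hvw : v ≠ w) (m : ℕ) :
    ∃ Q : Finset Plane, Generic Q ∧ P ⊆ Q ∧ Q.card = P.card + 2 * m ∧
      imbalance Q (f v) (f w) = imbalance P (f v) (f w) + 2 * m ∧
      ∀ x y, x ≠ y → s(x, y) ≠ s(v, w) →
        imbalance Q (f x) (f y) = imbalance P (f x) (f y) := by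
  induction m with
  | zero => exact ⟨P, hP, subset_rfl, by simp, by simp, fun _ _ _ _ => rfl⟩
  | succ m ih =>
    obtain ⟨Q, hQ, hPQ, hc, hi, ho⟩ := ih
    obtain ⟨R, hR, hQR, hc', hi', ho'⟩ := hf.exists_add_pair hQ (fun v => hPQ (hfP v)) hvw
    refine ⟨R, hR, hPQ.trans hQR, by omega, ?_, fun x y hxy hs => ?_⟩
    · rw [hi', hi]
      push_cast
      ring
    · rw [ho' x y hxy hs, ho x y hxy hs]

/-- The line through two of the points can be balanced at the cost of as many new points as its
imbalance. -/
theorem NoParallels.exists_balance (hf : NoParallels f) {P : Finset Plane} (hP : Generic P)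
    (hfP : ∀ v, f v ∈ P) {v w : V} (hvw : v ≠ w) (he : Even (imbalance P (f v) (f w))) :
    ∃ Q : Finset Plane, Generic Q ∧ P ⊆ Q ∧ Even ((Q.card : ℤ) - P.card) ∧
      (Q.card : ℤ) = P.card + |imbalance P (f v) (f w)| ∧
      imbalance Q (f v) (f w) = 0 ∧
      ∀ x y, x ≠ y → s(x, y) ≠ s(v, w) →
        imbalance Q (f x) (f y) = imbalance P (f x) (f y) := by
  -- New points always go to the left, so direct the line with its deficient side there.
  wlog h : imbalance P (f v) (f w) ≤ 0 generalizing v w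
  · obtain ⟨Q, h1, h2, h3, h4, h5, h6⟩ := this hvw.symm
      (by rw [imbalance_swap]; exact he.neg) (by rw [imbalance_swap]; omega)
    rw [imbalance_swap, abs_neg] at h4
    rw [imbalance_swap, neg_eq_zero] at h5
    rw [Sym2.eq_swap] at h6
    exact ⟨Q, h1, h2, h3, h4, h5, h6⟩
  obtain ⟨d, hd⟩ := he
  obtain ⟨Q, h1, h2, h3, h4, h5⟩ := hf.exists_add_pairs hP hfP hvw (-d).toNat
  refine ⟨Q, h1, h2, ⟨-d, by omega⟩, ?_, by omega, h5⟩
  rw [abs_of_nonpos h]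
  omega

/-- The line through two of the points can be unbalanced by adding at most two points. -/
theorem NoParallels.exists_unbalance (hf : NoParallels f) {P : Finset Plane} (hP : Generic P)
    (hfP : ∀ v, f v ∈ P) {v w : V} (hvw : v ≠ w) :
    ∃ Q : Finset Plane, Generic Q ∧ P ⊆ Q ∧ Even ((Q.card : ℤ) - P.card) ∧
      (Q.card : ℤ) ≤ P.card + 2 ∧ imbalance Q (f v) (f w) ≠ 0 ∧
      ∀ x y, x ≠ y → s(x, y) ≠ s(v, w) →
        imbalance Q (f x) (f y) = imbalance P (f x) (f y) := by
  by_cases h : imbalance P (f v) (f w) = 0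
  · obtain ⟨Q, h1, h2, h3, h4, h5⟩ := hf.exists_add_pair hP hfP hvw
    exact ⟨Q, h1, h2, ⟨1, by omega⟩, by omega, by omega, h5⟩
  · exact ⟨P, hP, subset_rfl, by simp, by omega, h, fun _ _ _ _ => rfl⟩

open Classical in
-- Untreated pairs keep their imbalance from `P`, so the cost of an edge is bounded by the size of
-- `P`, not of the growing set.
theorem NoParallels.exists_realization (hf : NoParallels f) {P : Finset Plane} (hP : Generic P)
    (hfP : ∀ v, f v ∈ P) (hPe : Even P.card) (G : SimpleGraph V) (S : Finset (Sym2 V))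
    (hS : ∀ z ∈ S, ¬ z.IsDiag) :
    ∃ Q : Finset Plane, Generic Q ∧ P ⊆ Q ∧ Even ((Q.card : ℤ) - P.card) ∧
      (Q.card : ℤ) ≤ P.card + ∑ z ∈ S, (if z ∈ G.edgeSet then (P.card : ℤ) - 2 else 2) ∧
      (∀ x y, s(x, y) ∈ S → (imbalance Q (f x) (f y) = 0 ↔ G.Adj x y)) ∧
      ∀ x y, x ≠ y → s(x, y) ∉ S →
        imbalance Q (f x) (f y) = imbalance P (f x) (f y) := by
  induction S using Finset.induction_on with
  | empty => exact ⟨P, hP, subset_rfl, by simp, by simp, by simp, fun _ _ _ _ => rfl⟩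
  | insert z S hz ih =>
    obtain ⟨Q, hQ, hPQ, he, hc, hin, hout⟩ := ih fun z hz => hS z (Finset.mem_insert_of_mem hz)
    rw [Finset.sum_insert hz]
    induction z using Sym2.ind with
    | _ v w =>
    have hvw : v ≠ w := fun h => hS _ (Finset.mem_insert_self _ _) (Sym2.mk_isDiag_iff.2 h)
    have hcard := hP.card_leftSide_add_card_rightSide (hfP v) (hfP w) (hf.injective.ne hvw)
    have hI := hout v w hvw hz
    obtain ⟨R, hR, hQR, he', hc', hvw', ho'⟩ : ∃ R : Finset Plane, Generic R ∧ Q ⊆ R ∧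
        Even ((R.card : ℤ) - Q.card) ∧
        (R.card : ℤ) ≤ Q.card + (if s(v, w) ∈ G.edgeSet then (P.card : ℤ) - 2 else 2) ∧
        (imbalance R (f v) (f w) = 0 ↔ G.Adj v w) ∧
        ∀ x y, x ≠ y → s(x, y) ≠ s(v, w) →
          imbalance R (f x) (f y) = imbalance Q (f x) (f y) := by
      by_cases h : G.Adj v w
      · have hIe : Even (imbalance Q (f v) (f w)) := by
          rw [hI]
          unfold imbalance
          obtain ⟨d, hd⟩ := hPe
          -- Left + right = `2d - 2`, so left - right is twice this witness.
          exact ⟨d - 1 - (rightSide P (f v) (f w)).card, by omega⟩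
        obtain ⟨R, h1, h2, h3, h4, h5, h6⟩ :=
          hf.exists_balance hQ (fun v => hPQ (hfP v)) hvw hIe
        refine ⟨R, h1, h2, h3, ?_, by simp [h, h5], h6⟩
        have : |imbalance Q (f v) (f w)| ≤ (P.card : ℤ) - 2 := by
          rw [hI, abs_le]
          unfold imbalance
          omega
        rw [if_pos (by simpa using h)]
        omega
      · obtain ⟨R, h1, h2, h3, h4, h5, h6⟩ :=
          hf.exists_unbalance hQ (fun v => hPQ (hfP v)) hvw
        refine ⟨R, h1, h2, h3, ?_, by simp [h, h5], h6⟩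
        rw [if_neg (by simpa using h)]
        exact h4
    refine ⟨R, hR, hPQ.trans hQR, ?_, by linarith, ?_, ?_⟩
    · simpa using he'.add he
    · intro x y hxy
      by_cases hs : s(x, y) = s(v, w)
      · rcases Sym2.eq_iff.1 hs with ⟨rfl, rfl⟩ | ⟨rfl, rfl⟩
        · exact hvw'
        · rw [imbalance_swap, neg_eq_zero, hvw', G.adj_comm]
      · have hxS := (Finset.mem_insert.1 hxy).resolve_left hs
        rw [ho' x y (fun h => hS _ hxy (Sym2.mk_isDiag_iff.2 h)) hs]
        exact hin x y hxS
    · intro x y hxy hs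
      rw [Finset.mem_insert, not_or] at hs
      rw [ho' x y hxy hs.1, hout x y hxy hs.2]

/-! ### Points on a parabola -/

/-- Uniqueness of binary expansions. -/
theorem two_pow_add_two_pow_ne {i j k l : ℕ} (hij : i ≠ j) (hkl : k ≠ l)
    (h : s(i, j) ≠ s(k, l)) : 2 ^ i + 2 ^ j ≠ 2 ^ k + 2 ^ l := by
  intro he
  have : ({i, j} : Finset ℕ) = {k, l} := by
    apply Finset.geomSum_injective le_rfl
    simpa [Finset.sum_pair hij, Finset.sum_pair hkl] using he
  apply h
  have hi : i ∈ ({k, l} : Finset ℕ) := this ▸ (by simp)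
  have hj : j ∈ ({k, l} : Finset ℕ) := this ▸ (by simp)
  simp only [Finset.mem_insert, Finset.mem_singleton] at hi hj
  rw [Sym2.eq_iff]
  omega

/-- The point with abscissa `2 ^ i` on the standard parabola. -/
noncomputable def parabolaPoint (i : ℕ) : Plane := !₂[2 ^ i, (2 ^ i) ^ 2]

theorem two_pow_real_injective : Function.Injective fun i : ℕ => (2 : ℝ) ^ i :=
  pow_right_injective₀ (by norm_num) (by norm_num)

theorem noParallels_parabolaPoint : NoParallels parabolaPoint where
  injective i j h := by
    have := congrArg (fun p : Plane => p 0) h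
    simp only [parabolaPoint] at this
    exact two_pow_real_injective (by simpa using this)
  cross_ne_zero i j k l hij hkl h := by
    have h1 : (2 : ℝ) ^ j - 2 ^ i ≠ 0 := sub_ne_zero.2 (two_pow_real_injective.ne hij.symm)
    have h2 : (2 : ℝ) ^ l - 2 ^ k ≠ 0 := sub_ne_zero.2 (two_pow_real_injective.ne hkl.symm)
    have h3 : ((2 : ℝ) ^ k + 2 ^ l) - (2 ^ i + 2 ^ j) ≠ 0 := by
      rw [sub_ne_zero]
      exact_mod_cast (two_pow_add_two_pow_ne hij hkl h).symm
    -- A chord of the parabola has as slope the sum of its two abscissas, so parallel chords would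
    -- have equal sums.
    have : cross (parabolaPoint i) (parabolaPoint j) (parabolaPoint k) (parabolaPoint l) =
        (2 ^ j - 2 ^ i) * (2 ^ l - 2 ^ k) * ((2 ^ k + 2 ^ l) - (2 ^ i + 2 ^ j)) := by
      simp [cross, parabolaPoint]
      ring
    rw [this]
    exact mul_ne_zero (mul_ne_zero h1 h2) h3

theorem NoParallels.comp {W : Type*} {f : W → Plane} (hf : NoParallels f) {U : Type*} {g : U → W}
    (hg : Function.Injective g) : NoParallels (f ∘ g) where
  injective := hf.injective.comp hg
  cross_ne_zero v w x y hvw hxy h := by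
    refine hf.cross_ne_zero _ _ _ _ (hg.ne hvw) (hg.ne hxy) fun h' => h ?_
    rw [Sym2.eq_iff] at h' ⊢
    simpa [hg.eq_iff] using h'

/-- A collinear triple would give two parallel lines sharing a point; `orient x y z` unfolds to
`cross x y x z`. -/
theorem NoParallels.generic {W : Type*} {f : W → Plane} (hf : NoParallels f) {P : Finset Plane}
    (hP : ∀ p ∈ P, ∃ v, f v = p) : Generic P := by
  intro p hp q hq r hr hpq hpr hqr
  obtain ⟨x, rfl⟩ := hP p hp
  obtain ⟨y, rfl⟩ := hP q hq
  obtain ⟨z, rfl⟩ := hP r hr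
  refine hf.cross_ne_zero x y x z (fun h => hpq (h ▸ rfl)) (fun h => hpr (h ▸ rfl)) fun h => ?_
  rw [Sym2.congr_right] at h
  exact hqr (h ▸ rfl)

theorem exists_noParallels (V : Type*) [Finite V] : ∃ f : V → Plane, NoParallels f := by
  obtain ⟨n, ⟨e⟩⟩ := Finite.exists_equiv_fin V
  exact ⟨_, noParallels_parabolaPoint.comp (g := fun v => (e v : ℕ))
    (Fin.val_injective.comp e.injective)⟩

end HalvingLines

theorem mainTheorem6 {V : Type*} [Fintype V] (G : SimpleGraph V) [Fintype G.edgeSet]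
    (k e : ℕ) (hV : Fintype.card V = 2 * k) (he : G.edgeFinset.card = e) :
    ∃ P : Finset HalvingLines.Plane,
      Even P.card ∧
      HalvingLines.InGeneralPosition P ∧
      G.IsIndContained (HalvingLines.underlyingGraph P) ∧
      (P.card : ℤ) ≤ 2 * k + 2 * e * k - 4 * e + 2 * ((2 * k).choose 2 : ℤ) := by
  classical
  obtain ⟨f, hf⟩ := HalvingLines.exists_noParallels V
  have hcard : (Finset.univ.image f).card = 2 * k := by
    rw [Finset.card_image_of_injective _ hf.injective, Finset.card_univ, hV]
  obtain ⟨Q, hQ, hPQ, hev, hc, hadj, -⟩ := hf.exists_realization (P := Finset.univ.image f)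
    (hf.generic fun p hp => by simpa using hp) (fun v => by simp) (by rw [hcard]; simp) G
    -- The edges of the complete graph are all the pairs to be treated.
    (⊤ : SimpleGraph V).edgeFinset (fun z hz => SimpleGraph.not_isDiag_of_mem_edgeFinset hz)
  have hfQ : ∀ v, f v ∈ Q := fun v => hPQ (by simp)
  rw [hcard] at hev hc
  refine ⟨Q, ?_, hQ.inGeneralPosition, ⟨⟨⟨fun v => ⟨f v, hfQ v⟩, fun v w h =>
    hf.injective (congrArg Subtype.val h)⟩, ?_⟩⟩, ?_⟩
  · obtain ⟨d, hd⟩ := hev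
    rw [Nat.even_iff]
    omega
  · intro v w
    change HalvingLines.IsHalvingLine Q (f v) (f w) ↔ G.Adj v w
    by_cases hvw : v = w
    · subst hvw
      simp [HalvingLines.IsHalvingLine]
    · rw [← hadj v w (by simpa using hvw)]
      unfold HalvingLines.imbalance HalvingLines.IsHalvingLine
      rw [sub_eq_zero, Nat.cast_inj]
      simp [hfQ, hf.injective.ne hvw]
  · have hsub : (⊤ : SimpleGraph V).edgeFinset.filter (· ∈ G.edgeSet) = G.edgeFinset := by
      ext z
      simp only [Finset.mem_filter, SimpleGraph.mem_edgeFinset]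
      exact ⟨fun h => h.2, fun h => ⟨SimpleGraph.edgeSet_mono le_top h, h⟩⟩
    have hall : (⊤ : SimpleGraph V).edgeFinset.card = (2 * k).choose 2 := by
      rw [SimpleGraph.card_edgeFinset_top_eq_card_choose_two, hV]
    have hsplit := Finset.card_filter_add_card_filter_not
      (s := (⊤ : SimpleGraph V).edgeFinset) (· ∈ G.edgeSet)
    rw [hsub, hall, he] at hsplit
    rw [Finset.sum_ite, Finset.sum_const, Finset.sum_const, hsub, he, nsmul_eq_mul,
      nsmul_eq_mul] at hc
    push_cast at hc
    rw [← hsplit]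
    push_cast
    linarith
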